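/- All graphs are finite, undirected and without multiple edges; loops are allowed where indicated. For graphs $G$ and $H$, $\hom(G,H)$ is the number of maps $\phi:V(G)\to V(H)$ such that $\phi(u)\phi(v)\in E(H)$ for every $uv\in E(G)$. For graphs $H$ and $B$ (possibly with loops), $H^B$ is the graph whose vertices are all functions $V(B)\to V(H)$, with $f_1$ and $f_2$ adjacent (possibly $f_1=f_2$) if and only if $f_1(u)f_2(v)\in E(H)$ for all $u,v\in V(B)$ with $uv\in E(B)$. For a graph $F$, $l(F)$ denotes the subgraph of $F$ induced on the set of its looped vertices. Let $G$ be a loop-free $d$-regular graph on $n$ vertices. Then, for every graph $H$ (loops allowed) and every bipartite graph $B$, \[\hom(G, l(H^B)) \leq \hom(K_{d+1}, l(H^B))^{\frac{n}{d+1}},\] where $K_{d+1}$ is the complete loop-free graph on $d+1$ vertices. Moreover, if $H$ is a single edge with a loop at exactly one of its ends and $B=K_2$, then $l(H^B)$ is isomorphic to the Widom–Rowlinson graph $H_{\mathrm{WR}}$, the path on three vertices with a loop at each vertex. Consequently \[\hom(G,H_{\mathrm{WR}})\leq \hom(K_{d+1},H_{\mathrm{WR}})^{\frac{n}{d+1}}.\]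 -/

import Mathlib

/-- A graph without multiple edges in which loops are permitted: a symmetric adjacency relation
(`v` is looped when `Adj v v`). -/
@[ext]
structure LoopGraph (V : Type*) where
  /-- The adjacency relation. -/
  Adj : V → V → Prop
  /-- Edges are undirected. -/
  symm : ∀ u v, Adj u v → Adj v u

namespace LoopGraph

/-- A loop-free graph, regarded as a graph in which loops are permitted. -/
def ofSimple {V : Type*} (G : SimpleGraph V) : LoopGraph V where
  Adj := G.Adj
  symm _ _ h := SimpleGraph.Adj.symm h

/-- The number `hom(G, H)` of homomorphisms (adjacency-preserving vertex maps) from `G` to `H`.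
It is only used for finite graphs. -/
noncomputable def hom {V W : Type*} (G : LoopGraph V) (H : LoopGraph W) : ℕ :=
  Nat.card (G.Adj →r H.Adj)

/-- The graph exponential `A ^ B`: its vertices are all functions from the vertices of `B` to the
vertices of `A`, and `f₁`, `f₂` are adjacent iff `f₁ u`, `f₂ v` are adjacent in `A` whenever
`u`, `v` are adjacent in `B`. -/
def exponent {U W : Type*} (A : LoopGraph U) (B : LoopGraph W) : LoopGraph (W → U) where
  Adj f₁ f₂ := ∀ u v, B.Adj u v → A.Adj (f₁ u) (f₂ v)
  symm _ _ h u v huv := A.symm _ _ (h v u (B.symm u v huv))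

/-- `l(G)`: the subgraph of `G` induced on the set of looped vertices of `G`. -/
def looped {V : Type*} (G : LoopGraph V) : LoopGraph {v : V // G.Adj v v} where
  Adj u v := G.Adj u.1 v.1
  symm u v h := G.symm u.1 v.1 h

/-- A single edge `{0, 1}` with a loop at the end `0` and none at the end `1`. -/
def loopedEdge : LoopGraph (Fin 2) where
  Adj u v := u = 0 ∨ v = 0
  symm _ _ h := h.symm

/-- The Widom–Rowlinson graph: the path `0 - 1 - 2` with a loop at each of its vertices. -/
def widomRowlinson : LoopGraph (Fin 3) where
  Adj u v := (u : ℕ) ≤ v + 1 ∧ (v : ℕ) ≤ u + 1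
  symm _ _ h := ⟨h.2, h.1⟩

end LoopGraph

/-!
Write `G°` for `G` with a loop added at every vertex. A homomorphism from `G` to `l(H ^ B)` is a
homomorphism from `G° × B` to `H`. If `B` has sides `L` and `R`, it assigns to each vertex of `G` a
function `L → U` and a function `R → U`, and the condition relates only the first function at `u` to
the second at `v`, for `u` and `v` equal or adjacent (`LoopGraph.hom_looped_exponent`). So the count
is the number of homomorphisms from the bipartite graph `G° × K₂`, which is `(d + 1)`-regular, to a
bipartite target, and for `G = K_{d+1}` the graph `G° × K₂` is `K_{d+1,d+1}`.

It remains to prove the Galvin–Tetali inequality for such counts (`LoopGraph.doubleHom_le_rpow`).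
Once the values `x` on one side are fixed, the values on the other side are chosen independently, so
the count is `∑ x, ∏ v, m v x`, where `m v x` depends only on the `d + 1` coordinates of `x` in the
neighbourhood of `v`, and each coordinate matters to exactly `d + 1` of the factors. Finner's
generalization of Hölder's inequality, with all exponents `1 / (d + 1)`, bounds this by a product of
`n` equal factors, each being the `(d + 1)`-st root of the count for `K_{d+1,d+1}`. Finner's
inequality (`lmarginal_prod_rpow_le`) follows by integrating out one coordinate at a time and
applying Hölder's inequality to the factors in which that coordinate occurs.
-/

open scoped ENNReal

/-! ### Finner's inequality -/

open MeasureTheory in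
theorem pi_count {ι S : Type*} [Fintype ι] [Finite S] [MeasurableSpace S]
    [MeasurableSingletonClass S] :
    (Measure.pi fun _ : ι ↦ (Measure.count : Measure S)) = Measure.count := by
  refine Measure.ext_of_singleton fun x ↦ ?_
  rw [Measure.pi_singleton]
  simp

open MeasureTheory in
/-- **Finner's inequality**, for partial integrals: if the `w`-th function depends only on the
coordinates in `N w`, and the exponents of the functions involving any given coordinate sum to `1`,
then the integral of the product of powers is at most the product of the powers of the integrals. -/
theorem lmarginal_prod_rpow_le {ι κ : Type*} [DecidableEq ι] {X : ι → Type*}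
    [∀ i, MeasurableSpace (X i)] (μ : ∀ i, Measure (X i)) [∀ i, SigmaFinite (μ i)]
    (t : Finset κ) (N : κ → Finset ι) (p : κ → ℝ) (hp : ∀ w ∈ t, 0 ≤ p w)
    (hN : ∀ i, ∑ w ∈ t with i ∈ N w, p w = 1)
    (f : κ → (∀ i, X i) → ℝ≥0∞) (hf : ∀ w ∈ t, Measurable (f w))
    (hdep : ∀ w ∈ t, DependsOn (f w) (N w)) (s : Finset ι) (x : ∀ i, X i) :
    (∫⋯∫⁻_s, (fun x ↦ ∏ w ∈ t, f w x ^ p w) ∂μ) x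
      ≤ ∏ w ∈ t, ((∫⋯∫⁻_s ∩ N w, f w ∂μ) x) ^ p w := by
  have hmeas : Measurable fun x ↦ ∏ w ∈ t, f w x ^ p w :=
    Finset.measurable_prod _ fun w hw ↦ (hf w hw).pow_const _
  induction s using Finset.induction_on generalizing x with
  | empty => simp
  | insert i s hi ih =>
    rw [lmarginal_insert _ hmeas hi]
    -- Integrating out coordinate `i` changes only the factors `w` with `i ∈ N w`: the others do not
    -- depend on `i`, and Hölder's inequality applies to those that do.
    have hout : ∀ w ∈ t, i ∉ N w → ∀ y : X i,
        (∫⋯∫⁻_s ∩ N w, f w ∂μ) (Function.update x i y)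
          = (∫⋯∫⁻_(insert i s) ∩ N w, f w ∂μ) x := by
      intro w hw hiw y
      rw [Finset.insert_inter_of_notMem hiw, lmarginal_update_of_notMem (hf w hw) (by simp [hiw])]
      congr 1
      funext z
      refine hdep w hw fun j hj ↦ ?_
      have : j ≠ i := by rintro rfl; exact hiw hj
      simp [this]
    have hin : ∀ w ∈ t, i ∈ N w →
        ∫⁻ y, (∫⋯∫⁻_s ∩ N w, f w ∂μ) (Function.update x i y) ∂μ i
          = (∫⋯∫⁻_(insert i s) ∩ N w, f w ∂μ) x := by
      intro w hw hiw
      rw [Finset.insert_inter_of_mem hiw, lmarginal_insert _ (hf w hw) (by simp [hi])]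
    calc ∫⁻ y, (∫⋯∫⁻_s, (fun x ↦ ∏ w ∈ t, f w x ^ p w) ∂μ) (Function.update x i y) ∂μ i
        ≤ ∫⁻ y, ∏ w ∈ t, ((∫⋯∫⁻_s ∩ N w, f w ∂μ) (Function.update x i y)) ^ p w ∂μ i :=
          lintegral_mono fun y ↦ ih _
      _ = ∫⁻ y, (∏ w ∈ t with i ∉ N w, ((∫⋯∫⁻_(insert i s) ∩ N w, f w ∂μ) x) ^ p w) *
            ∏ w ∈ t with i ∈ N w,
              ((∫⋯∫⁻_s ∩ N w, f w ∂μ) (Function.update x i y)) ^ p w ∂μ i := by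
          refine lintegral_congr fun y ↦ ?_
          rw [← Finset.prod_filter_mul_prod_filter_not t (fun w ↦ i ∈ N w), mul_comm]
          congr 1
          refine Finset.prod_congr rfl fun w hw ↦ ?_
          rw [Finset.mem_filter] at hw
          rw [hout w hw.1 hw.2]
      _ = (∏ w ∈ t with i ∉ N w, ((∫⋯∫⁻_(insert i s) ∩ N w, f w ∂μ) x) ^ p w) *
            ∫⁻ y, ∏ w ∈ t with i ∈ N w,
              ((∫⋯∫⁻_s ∩ N w, f w ∂μ) (Function.update x i y)) ^ p w ∂μ i := by
          refine lintegral_const_mul _ (Finset.measurable_prod _ fun w hw ↦ ?_)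
          exact (((hf w (Finset.mem_filter.1 hw).1).lmarginal μ).comp
            (measurable_update x)).pow_const _
      _ ≤ (∏ w ∈ t with i ∉ N w, ((∫⋯∫⁻_(insert i s) ∩ N w, f w ∂μ) x) ^ p w) *
            ∏ w ∈ t with i ∈ N w,
              (∫⁻ y, (∫⋯∫⁻_s ∩ N w, f w ∂μ) (Function.update x i y) ∂μ i) ^ p w := by
          gcongr
          refine ENNReal.lintegral_prod_norm_pow_le _ (fun w hw ↦ ?_) (hN i)
            fun w hw ↦ hp w (Finset.mem_filter.1 hw).1
          exact (((hf w (Finset.mem_filter.1 hw).1).lmarginal μ).comp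
            (measurable_update x)).aemeasurable
      _ = ∏ w ∈ t, ((∫⋯∫⁻_(insert i s) ∩ N w, f w ∂μ) x) ^ p w := by
          rw [← Finset.prod_filter_mul_prod_filter_not t (fun w ↦ i ∈ N w), mul_comm]
          congr 1
          refine Finset.prod_congr rfl fun w hw ↦ ?_
          rw [Finset.mem_filter] at hw
          rw [hin w hw.1 hw.2]

open MeasureTheory in
/-- Finner's inequality for finite sums. -/
theorem sum_prod_rpow_le {ι κ S : Type*} [Fintype ι] [DecidableEq ι] [Fintype κ] [Fintype S]
    (N : κ → Finset ι) (p : κ → ℝ) (hp : ∀ w, 0 ≤ p w)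
    (hN : ∀ i, ∑ w with i ∈ N w, p w = 1) (F : ∀ w, (N w → S) → ℝ≥0∞) :
    ∑ x : ι → S, ∏ w, F w (fun i ↦ x i) ^ p w ≤ ∏ w, (∑ y, F w y) ^ p w := by
  -- On a finite type carrying the discrete σ-algebra, sums are integrals for the counting measure.
  let _ : MeasurableSpace S := ⊤
  rcases isEmpty_or_nonempty (ι → S) with h | ⟨⟨x⟩⟩
  · simp
  have key := lmarginal_prod_rpow_le (fun _ : ι ↦ (Measure.count : Measure S)) Finset.univ N p
    (fun w _ ↦ hp w) hN (fun w x ↦ F w fun i ↦ x i) (fun _ _ ↦ measurable_of_finite _)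
    (fun w _ x y hxy ↦ congrArg _ (funext fun i ↦ hxy i i.2)) Finset.univ x
  have hw : ∀ w, (∫⋯∫⁻_(N w), (fun x : ι → S ↦ F w fun i ↦ x i)
      ∂(fun _ ↦ Measure.count)) x = ∑ y, F w y := by
    intro w
    simp [lmarginal, pi_count, lintegral_count, Function.updateFinset, tsum_fintype]
  simpa [pi_count, lintegral_count, hw] using key

namespace LoopGraph

/-! ### The Galvin–Tetali inequality -/

/-- The number of pairs of maps `x : V → S`, `y : V → T` such that `x u` and `y v` are related by
`r` whenever `u` and `v` are adjacent. These are the homomorphisms from the bipartite double cover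
`G × K₂` to the bipartite graph of `r` which respect the two sides. -/
noncomputable def doubleHom {V S T : Type*} (G : LoopGraph V) (r : S → T → Prop) : ℕ :=
  Nat.card {q : (V → S) × (V → T) // ∀ u v, G.Adj u v → r (q.1 u) (q.2 v)}

/-- Given `x`, the values of `y` at distinct vertices can be chosen independently. -/
theorem doubleHom_eq_sum {V S T : Type*} [Fintype V] [DecidableEq V] [Fintype S] [Finite T] (G : LoopGraph V)
    (r : S → T → Prop) :
    G.doubleHom r = ∑ x : V → S, ∏ v, Nat.card {b : T // ∀ u, G.Adj u v → r (x u) b} := by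
  have e : {q : (V → S) × (V → T) // ∀ u v, G.Adj u v → r (q.1 u) (q.2 v)} ≃
      Σ x : V → S, ∀ v, {b : T // ∀ u, G.Adj u v → r (x u) b} :=
    { toFun q := ⟨q.1.1, fun v ↦ ⟨q.1.2 v, fun u h ↦ q.2 u v h⟩⟩
      invFun s := ⟨(s.1, fun v ↦ (s.2 v).1), fun u v h ↦ (s.2 v).2 u h⟩
      left_inv _ := rfl
      right_inv _ := rfl }
  rw [doubleHom, Nat.card_congr e, Nat.card_sigma]
  simp [Nat.card_pi]

/-- The graph on `V` in which any two vertices, equal or not, are adjacent. -/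
def full (V : Type*) : LoopGraph V where
  Adj _ _ := True
  symm _ _ h := h

/-- The Galvin–Tetali inequality for the bipartite double cover of a `k`-regular graph. -/
theorem doubleHom_le_rpow {V S T : Type*} [Fintype V] [Finite S] [Finite T] (G : LoopGraph V)
    {k : ℕ} (hk : k ≠ 0) (hG : ∀ v, Nat.card {u // G.Adj u v} = k) (r : S → T → Prop) :
    (G.doubleHom r : ℝ) ≤ ((full (Fin k)).doubleHom r : ℝ) ^ ((Fintype.card V : ℝ) / k) := by
  classical
  have := Fintype.ofFinite S
  have hk' : (k : ℝ) ≠ 0 := by exact_mod_cast hk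
  let N : V → Finset V := fun v ↦ {u | G.Adj u v}
  have hN : ∀ v, (N v).card = k := fun v ↦ by
    rw [← hG v, Nat.card_eq_fintype_card, Fintype.card_subtype]
  have hN' : ∀ u, ∑ v with u ∈ N v, (k : ℝ)⁻¹ = 1 := by
    intro u
    have : ({v | u ∈ N v} : Finset V) = N u := by
      ext v
      simpa [N] using ⟨G.symm _ _, G.symm _ _⟩
    rw [this, Finset.sum_const, hN, nsmul_eq_mul, mul_inv_cancel₀ hk']
  -- `m y` is the number of common neighbours of the values of `y`.
  let m : ∀ v, (N v → S) → ℕ := fun v y ↦ Nat.card {b : T // ∀ i, r (y i) b}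
  have key := sum_prod_rpow_le N (fun _ ↦ (k : ℝ)⁻¹) (fun _ ↦ by positivity) hN'
    (fun v y ↦ (m v y : ℝ≥0∞) ^ k)
  have hl : ∑ x : V → S, ∏ v, ((m v (fun i ↦ x i) : ℝ≥0∞) ^ k) ^ (k : ℝ)⁻¹
      = (G.doubleHom r : ℝ≥0∞) := by
    rw [doubleHom_eq_sum]
    push_cast
    refine Finset.sum_congr rfl fun x _ ↦ Finset.prod_congr rfl fun v _ ↦ ?_
    rw [← ENNReal.rpow_natCast, ENNReal.rpow_rpow_inv hk']
    simp [m, N]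
  have hr : ∀ v, ∑ y : N v → S, (m v y : ℝ≥0∞) ^ k = ((full (Fin k)).doubleHom r : ℝ≥0∞) := by
    intro v
    rw [doubleHom_eq_sum]
    push_cast
    let e : N v ≃ Fin k := Fintype.equivFinOfCardEq (by simp [hN])
    refine Fintype.sum_equiv (e.arrowCongr (Equiv.refl S)) _ _ fun y ↦ ?_
    have : m v y = Nat.card {b : T // ∀ u, r (y (e.symm u)) b} :=
      Nat.card_congr (Equiv.subtypeEquivRight fun b ↦ e.symm.surjective.forall)
    simp [full, this]
  rw [hl] at key
  simp only [hr, Finset.prod_const, Finset.card_univ] at key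
  rw [← ENNReal.rpow_natCast, ← ENNReal.rpow_mul] at key
  have h2 := ENNReal.toReal_mono (ENNReal.rpow_ne_top_of_nonneg (by positivity) (by simp)) key
  rw [← ENNReal.toReal_rpow] at h2
  simpa [div_eq_inv_mul] using h2

/-! ### Homomorphisms to the looped part of an exponential -/

/-- The graph `G` with a loop added at every vertex. -/
def addLoops {V : Type*} (G : SimpleGraph V) : LoopGraph V where
  Adj u v := u = v ∨ G.Adj u v
  symm _ _ h := h.imp Eq.symm SimpleGraph.Adj.symm

/-- A homomorphism from `G` to `l(H ^ B)` is the same as a homomorphism from `G° × B` to `H`, where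
`G°` is `G` with all loops added; a partition of `B` into independent sets `L` and `R` turns it into
a homomorphism from `G° × K₂` to the bipartite graph with sides `L → U` and `R → U`. -/
theorem hom_looped_exponent {V U W : Type*} (G : SimpleGraph V) (H : LoopGraph U)
    (B : SimpleGraph W) (L : W → Prop) (hL : ∀ a b, B.Adj a b → (L a ↔ ¬ L b)) :
    (ofSimple G).hom (H.exponent (ofSimple B)).looped =
      (addLoops G).doubleHom fun (f : {a // L a} → U) (g : {a // ¬ L a} → U) ↦
        ∀ a b, B.Adj a.1 b.1 → H.Adj (f a) (g b) := by
  classical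
  refine Nat.card_congr ?_
  exact
    { toFun φ := ⟨(fun v a ↦ (φ v).1 a, fun v a ↦ (φ v).1 a), by
        rintro u v (rfl | h) a b hab
        · exact (φ u).2 a b hab
        · exact φ.map_rel h a b hab⟩
      invFun q :=
        have hq : ∀ u v, u = v ∨ G.Adj u v → ∀ a b, B.Adj a b →
            H.Adj (if h : L a then q.1.1 u ⟨a, h⟩ else q.1.2 u ⟨a, h⟩)
              (if h : L b then q.1.1 v ⟨b, h⟩ else q.1.2 v ⟨b, h⟩) := by
          intro u v huv a b hab
          by_cases ha : L a
          · have hb := (hL a b hab).1 ha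
            rw [dif_pos ha, dif_neg hb]
            exact q.2 u v huv _ _ hab
          · have hb : L b := by
              by_contra hb
              exact ha ((hL a b hab).2 hb)
            rw [dif_neg ha, dif_pos hb]
            exact H.symm _ _ (q.2 v u (huv.imp Eq.symm SimpleGraph.Adj.symm) _ _ hab.symm)
        { toFun v := ⟨fun a ↦ if h : L a then q.1.1 v ⟨a, h⟩ else q.1.2 v ⟨a, h⟩,
            hq v v (Or.inl rfl)⟩
          map_rel' := fun h ↦ hq _ _ (Or.inr h) }
      left_inv φ := by
        ext v a
        by_cases ha : L a <;> simp
      right_inv q := by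
        refine Subtype.ext (Prod.ext ?_ ?_) <;> funext v a <;> simp [a.2] }

theorem hom_congr_right {V W W' : Type*} (G : LoopGraph V) {H : LoopGraph W} {H' : LoopGraph W'}
    (e : H.Adj ≃r H'.Adj) : G.hom H = G.hom H' :=
  Nat.card_congr
    { toFun φ := e.toRelEmbedding.toRelHom.comp φ
      invFun φ := e.symm.toRelEmbedding.toRelHom.comp φ
      left_inv φ := by ext; simp
      right_inv φ := by ext; simp }

theorem hom_looped_exponent_le {V U W : Type*} [Fintype V] [Finite U] [Finite W] {d : ℕ}
    (G : SimpleGraph V) [DecidableRel G.Adj] (hG : G.IsRegularOfDegree d) (H : LoopGraph U)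
    (B : SimpleGraph W) (hB : B.IsBipartite) :
    ((ofSimple G).hom (H.exponent (ofSimple B)).looped : ℝ) ≤
      ((ofSimple (⊤ : SimpleGraph (Fin (d + 1)))).hom
        (H.exponent (ofSimple B)).looped : ℝ) ^ ((Fintype.card V : ℝ) / ((d : ℝ) + 1)) := by
  classical
  obtain ⟨c⟩ := hB
  -- The first side of `B` is the colour class of `0`.
  have hL : ∀ a b, B.Adj a b → (c a = 0 ↔ ¬ c b = 0) := by
    intro a b hab
    have := c.valid hab
    lia
  have hfull : addLoops (⊤ : SimpleGraph (Fin (d + 1))) = full (Fin (d + 1)) := by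
    ext u v
    simp [addLoops, full, em]
  rw [hom_looped_exponent G H B _ hL, hom_looped_exponent _ H B _ hL, hfull]
  have := doubleHom_le_rpow (addLoops G) d.succ_ne_zero (fun v ↦ ?_)
    fun (f : {a // c a = 0} → U) (g : {a // ¬ c a = 0} → U) ↦
      ∀ a b, B.Adj a.1 b.1 → H.Adj (f a) (g b)
  · simpa using this
  · have h : ({u | (addLoops G).Adj u v} : Finset V) = insert v (G.neighborFinset v) := by
      ext u
      simp [addLoops, G.adj_comm]
    rw [Nat.card_eq_fintype_card, Fintype.card_subtype, h,
      Finset.card_insert_of_notMem (by simp), G.card_neighborFinset_eq_degree, hG v]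

/-! ### The Widom–Rowlinson graph -/

/-- A looped vertex of the exponential is a function `f` that is `0` at `0` or at `1`; the middle
vertex of the path is the zero function. -/
theorem nonempty_iso_widomRowlinson :
    Nonempty ((loopedEdge.exponent (ofSimple (⊤ : SimpleGraph (Fin 2)))).looped.Adj ≃r
      widomRowlinson.Adj) := by
  have hadj : ∀ f g : Fin 2 → Fin 2,
      (loopedEdge.exponent (ofSimple (⊤ : SimpleGraph (Fin 2)))).Adj f g ↔
        (f 0 = 0 ∨ g 1 = 0) ∧ (f 1 = 0 ∨ g 0 = 0) := by
    intro f g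
    simp [exponent, ofSimple, loopedEdge, Fin.forall_fin_two]
  refine ⟨{
    toFun f := ![![1, 2], ![0, 0]] (f.1 0) (f.1 1)
    invFun i := ⟨![![1, 0], ![0, 0], ![0, 1]] i, by rw [hadj]; revert i; decide⟩
    left_inv := ?_
    right_inv := by
      intro i
      dsimp only
      revert i
      decide
    map_rel_iff' := ?_ }⟩
  · rintro ⟨f, hf⟩
    rw [Subtype.mk.injEq]
    dsimp only
    rw [hadj] at hf
    revert f
    decide
  · rintro ⟨f, hf⟩ ⟨g, hg⟩
    simp only [looped, hadj, widomRowlinson, Equiv.coe_fn_mk] at hf hg ⊢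
    revert f g
    decide

end LoopGraph

theorem theorem3 {V : Type*} [Fintype V] (n d : ℕ) (hn : Fintype.card V = n)
    (G : SimpleGraph V) [DecidableRel G.Adj] (hG : G.IsRegularOfDegree d) :
    (∀ (U : Type*) (W : Type*) [Finite U] [Finite W] (H : LoopGraph U) (B : SimpleGraph W),
      B.IsBipartite →
      ((LoopGraph.ofSimple G).hom (H.exponent (LoopGraph.ofSimple B)).looped : ℝ) ≤
        ((LoopGraph.ofSimple (⊤ : SimpleGraph (Fin (d + 1)))).hom
          (H.exponent (LoopGraph.ofSimple B)).looped : ℝ) ^ ((n : ℝ) / ((d : ℝ) + 1))) ∧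
    Nonempty
      ((LoopGraph.loopedEdge.exponent
          (LoopGraph.ofSimple (⊤ : SimpleGraph (Fin 2)))).looped.Adj ≃r
        LoopGraph.widomRowlinson.Adj) ∧
    ((LoopGraph.ofSimple G).hom LoopGraph.widomRowlinson : ℝ) ≤
      ((LoopGraph.ofSimple (⊤ : SimpleGraph (Fin (d + 1)))).hom
        LoopGraph.widomRowlinson : ℝ) ^ ((n : ℝ) / ((d : ℝ) + 1)) := by
  subst hn
  obtain ⟨e⟩ := LoopGraph.nonempty_iso_widomRowlinson
  refine ⟨fun U W _ _ H B hB ↦ LoopGraph.hom_looped_exponent_le G hG H B hB, ⟨e⟩, ?_⟩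
  rw [← LoopGraph.hom_congr_right _ e, ← LoopGraph.hom_congr_right _ e]
  exact LoopGraph.hom_looped_exponent_le G hG _ _ ⟨SimpleGraph.Coloring.mk id fun h ↦ h.ne⟩
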